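/- **Definitions.** Let $\lambda\ge\mu\ge\aleph_0$ be cardinals and let $I$ be a set with $|I|=\lambda$. A filter $\mathcal D$ on $I$ is *regular* if there are sets $X_i\in\mathcal D$ $(i<\lambda)$ such that $\bigcap_{i\in\sigma}X_i=\emptyset$ for every infinite $\sigma\subseteq\lambda$. Let $\mathcal G$ be a set of functions from $I$ to $\mu$. For a function $h$ whose domain is a finite subset of $\mathcal G$ and which satisfies $h(g)\in\mathrm{rn}(g)$ for all $g\in\mathrm{dom}(h)$, put $A_h=\{t\in I: g(t)=h(g)\text{ for all }g\in\mathrm{dom}(h)\}$. The triple $(I,\mathcal D,\mathcal G)$ is *$(\lambda,\mu)$-pre-good* if $\mathcal D$ is a regular filter on $I$ and $I\setminus A_h\notin\mathcal D$ for every such $h$; it is *$(\lambda,\mu)$-good* if moreover $\mathcal D$ is maximal under inclusion among the filters $\mathcal D'$ on $I$ for which $(I,\mathcal D',\mathcal G)$ is $(\lambda,\mu)$-pre-good. The theory $T_{rg}$ of the random graph, in the language with one binary relation symbol $R$, says that $R$ is irreflexive and symmetric and that for any finite disjoint sets $U,V$ of vertices there is a vertex outside $U\cup V$ that is adjacent to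 every element of $U$ and to no element of $V$. A structure $N$ is *$\kappa$-saturated* if for every $A\subseteq N$ with $|A|<\kappa$, every set of formulas in one free variable with parameters from $A$ that is finitely satisfiable in $N$ is realized in $N$. **Theorem.** Let $\mathcal D_0$ be a regular filter on $I$, let $\mathcal G$ be a set of functions from $I$ to $\mu$, and let $g_*:I\to\mu$ be a function with $g_*\notin\mathcal G$ and $\mathrm{rn}(g_*)=\mu$. Suppose that $(I,\mathcal D_0,\mathcal G\cup\{g_*\})$ is $(\lambda,\mu)$-good and that $\mu^+<\lambda$. Then there is a filter $\mathcal D\supseteq\mathcal D_0$ on $I$ such that (a) $(I,\mathcal D,\mathcal G)$ is $(\lambda,\mu)$-good; (b) for every ultrafilter $\mathcal D_*$ on $I$ extending $\mathcal D$ and every model $M\models T_{rg}$, the ultrapower $M^I/\mathcal D_*$ is not $\mu^{++}$-saturated. In particular, it is not $\lambda^+$-saturated. -/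

import Mathlib

open FirstOrder Cardinal

universe u v

/-! ### Regular filters and good triples -/

/-- A `lam`-regular filter on `I`: there is a family `⟨X i : i < lam⟩` of members of the filter
such that every infinite subfamily has empty intersection. -/
def IsRegularFilter {I : Type u} (lam : Cardinal.{u}) (D : Filter I) : Prop :=
  ∃ X : lam.ord.ToType → Set I,
    (∀ i, X i ∈ D) ∧ ∀ σ : Set lam.ord.ToType, σ.Infinite → (⋂ i ∈ σ, X i) = ∅

/-- `finSets G` is the family of all sets `A_h = {t | g t = h g for all g ∈ dom h}`, where `h` is a
function whose domain `s` is a finite subset of `G` and which satisfies `h g ∈ range g` for all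
`g ∈ s`. -/
def finSets {I K : Type*} (G : Set (I → K)) : Set (Set I) :=
  {A | ∃ (s : Finset (I → K)) (h : (I → K) → K), (s : Set (I → K)) ⊆ G ∧
    (∀ g ∈ s, h g ∈ Set.range g) ∧ A = {t | ∀ g ∈ s, g t = h g}}

/-- `(I, D, G)` is a `(lam, mu)`-pre-good triple: `ℵ₀ ≤ mu ≤ lam`, `I` has cardinality `lam`, `D` is
a regular filter on `I`, `G` is a set of functions from `I` to `mu` (the cardinal `mu` being the set
of ordinals below its initial ordinal), and every `A_h` in `finSets G` is nonempty modulo `D`,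
that is, its complement is not in `D`. (The empty `h` gives `A_h = I`, so `D` is proper.) -/
structure IsPreGoodTriple {I : Type u} (lam mu : Cardinal.{u}) (D : Filter I)
    (G : Set (I → mu.ord.ToType)) : Prop where
  aleph0_le : ℵ₀ ≤ mu
  le : mu ≤ lam
  card_eq : #I = lam
  regular : IsRegularFilter lam D
  nonempty_mod : ∀ A ∈ finSets G, Aᶜ ∉ D

/-- `(I, D, G)` is a `(lam, mu)`-good triple: it is pre-good, and `D` is maximal, with respect to
inclusion of filters as families of sets, among the filters for which it is. In Mathlib's order
on filters `D' ≤ D` says that `D'` contains every set of `D`. -/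
def IsGoodTriple {I : Type u} (lam mu : Cardinal.{u}) (D : Filter I)
    (G : Set (I → mu.ord.ToType)) : Prop :=
  IsPreGoodTriple lam mu D G ∧
    ∀ D' : Filter I, D' ≤ D → IsPreGoodTriple lam mu D' G → D' = D

/-! ### The theory of the random graph -/

/-- The extension axiom `E(m,n)`: for all `x_0, …, x_{m-1}` and `y_0, …, y_{n-1}`, if `x_i ≠ y_j`
for all `i, j`, then there is a `z`, different from all of them, which is adjacent to every `x_i`
and to no `y_j`. -/
noncomputable def extensionAxiom (m n : ℕ) : Language.graph.Sentence :=
  let x (i : Fin m) : Language.graph.Term (Empty ⊕ Fin (m + n + 1)) :=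
    &((Fin.castAdd n i).castSucc)
  let y (j : Fin n) : Language.graph.Term (Empty ⊕ Fin (m + n + 1)) :=
    &((Fin.natAdd m j).castSucc)
  let z : Language.graph.Term (Empty ⊕ Fin (m + n + 1)) := &(Fin.last (m + n))
  let distinct : Language.graph.BoundedFormula Empty (m + n + 1) :=
    Language.BoundedFormula.iInf fun p : Fin m × Fin n => ∼((x p.1) =' (y p.2))
  let joined : Language.graph.BoundedFormula Empty (m + n + 1) :=
    Language.BoundedFormula.iInf fun i : Fin m =>
      ∼(z =' (x i)) ⊓ Language.adj.boundedFormula₂ z (x i)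
  let unjoined : Language.graph.BoundedFormula Empty (m + n + 1) :=
    Language.BoundedFormula.iInf fun j : Fin n =>
      ∼(z =' (y j)) ⊓ ∼(Language.adj.boundedFormula₂ z (y j))
  ((distinct ⟹ (joined ⊓ unjoined)).ex).alls

/-- The theory of the random graph: the axioms of simple graphs and all extension axioms. -/
noncomputable def randomGraphTheory : Language.graph.Theory :=
  Language.Theory.simpleGraph ∪ Set.range fun p : ℕ × ℕ => extensionAxiom p.1 p.2

/-- The models of the theory of the random graph are the graphs with the extension property. -/
theorem model_randomGraphTheory_iff {M : Type v} [Language.graph.Structure M] :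
    M ⊨ randomGraphTheory ↔ M ⊨ Language.Theory.simpleGraph ∧
      ∀ (m n : ℕ) (x : Fin m → M) (y : Fin n → M), (∀ i j, x i ≠ y j) →
        ∃ z : M, (∀ i, z ≠ x i ∧ Language.Structure.RelMap Language.adj ![z, x i]) ∧
          ∀ j, z ≠ y j ∧ ¬ Language.Structure.RelMap Language.adj ![z, y j] := by
  have key : ∀ m n : ℕ, M ⊨ extensionAxiom m n ↔
      ∀ w : Fin (m + n) → M, ∃ z : M,
        (∀ i j, w (Fin.castAdd n i) ≠ w (Fin.natAdd m j)) →
        (∀ i, z ≠ w (Fin.castAdd n i) ∧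
          Language.Structure.RelMap Language.adj ![z, w (Fin.castAdd n i)]) ∧
        ∀ j, z ≠ w (Fin.natAdd m j) ∧
          ¬ Language.Structure.RelMap Language.adj ![z, w (Fin.natAdd m j)] := by
    intro m n
    rw [extensionAxiom, Language.Sentence.Realize, Language.BoundedFormula.realize_alls]
    simp [Language.BoundedFormula.realize_rel₂, -Fin.castSucc_natAdd]
  rw [randomGraphTheory, Language.Theory.model_union_iff]
  refine and_congr_right fun _ => ?_
  simp only [Language.Theory.model_iff, Set.forall_mem_range, Prod.forall, key]
  constructor
  · intro h m n x y hxy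
    obtain ⟨z, hz⟩ := h m n (Fin.append x y)
    simp only [Fin.append_left, Fin.append_right] at hz
    exact ⟨z, hz hxy⟩
  · intro h m n w
    obtain ⟨z0, -⟩ := h 0 0 Fin.elim0 Fin.elim0 fun i => i.elim0
    by_cases hw : ∀ i j, w (Fin.castAdd n i) ≠ w (Fin.natAdd m j)
    · obtain ⟨z, hz⟩ := h m n (fun i => w (Fin.castAdd n i)) (fun j => w (Fin.natAdd m j)) hw
      exact ⟨z, fun _ => hz⟩
    · exact ⟨z0, fun h' => absurd h' hw⟩

/-! ### Saturation -/

/-- The structure `N` is `κ`-saturated: for every set `A` of fewer than `κ` elements of `N`, every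
set of formulas in one free variable with parameters from `A` that is finitely satisfiable in `N`
is realized in `N`. -/
def IsSaturatedStructure (L : Language) (N : Type v) [L.Structure N]
    (κ : Cardinal.{u}) : Prop :=
  ∀ A : Set N, lift.{u} #A < lift.{v} κ → ∀ p : Set (L[[A]].Formula (Fin 1)),
    (∀ q : Finset (L[[A]].Formula (Fin 1)), (q : Set (L[[A]].Formula (Fin 1))) ⊆ p →
      ∃ b : N, ∀ φ ∈ q, φ.Realize fun _ => b) →
    ∃ b : N, ∀ φ ∈ p, φ.Realize fun _ => b

/-- The ultrapower `M^I / D`, whose language structure is Mathlib's ultraproduct structure. -/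
abbrev Ultrapower {I : Type*} (M : Type*) (D : Ultrafilter I) : Type _ :=
  (D : Filter I).Product fun _ : I => M

/-!
Let `G` be as in the theorem. The function `g_*` takes every value below `μ`, so composing it with
`μ⁺` independent functions on `μ` (`exists_independent_family`) gives functions `F j`, `j < μ⁺`, such
that `(I, D₀, G ∪ {F j : j < μ⁺})` is still pre-good; `D₀` extends to a filter `D₁` which makes it
good. Each `F j` is read as a pair `(x j, y j)` of functions from `I` to `ℕ`.

Modulo `D₁` the conditions `A_h` are dense, and a closing-off argument shows that every
`c : I → Set ℕ` is determined by at most `μ` of the functions in `G ∪ {F j}`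
(`IsGoodTriple.exists_small_support`), thus by `G` and the `F i` with `i < j`, for some `j < μ⁺`. On
the other hand, if `c` is determined by `G` and the `F i` with `i < j`, then the value of `F j` is
still free: a condition that decides enough statements `n ∈ c` leaves two numbers which `c` does not
separate, by the pigeonhole principle, and they can be made the values of `x j` and `y j`. The same
works for finitely many `c` and finitely many `j`, in increasing order. So the sets
`{x j ≠ y j ∧ (x j ∈ c ↔ y j ∈ c)}`, for all `j` and all `c` determined before `j`, can be added to
`D₁`, and the result is pre-good for `G` (`IsGoodTriple.exists_fooling`). The filter `D` is a maximal
extension.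

Let `D_*` be any ultrafilter extending `D`. Identify `ℕ` with a set of vertices of the model `M`.
A vertex of the ultrapower gives a function `c`, namely its neighbours in `ℕ`, hence there is a `j`
such that `c` contains both or none of `x j`, `y j` modulo `D_*`. So no vertex is adjacent to all
`x j` and to no `y j`. But this type over `μ⁺` parameters is finitely satisfiable, because `x i ≠ y j`
modulo `D` for all `i` and `j`.
-/

open Filter Set

/-! ### Conditions

The members of `finSets W` are thought of as the conditions with finite domain contained in `W`. -/

section

variable {I K : Type*}

theorem finSets_mono {W W' : Set (I → K)} (h : W ⊆ W') : finSets W ⊆ finSets W' := by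
  rintro A ⟨s, v, hs, hv, rfl⟩
  exact ⟨s, v, hs.trans h, hv, rfl⟩

/-- The set of all `t` which agree with `t₀` on finitely many members of `W` is a condition. By
`exists_eq_of_mem_finSets` every nonempty condition has this form. -/
theorem setOf_eq_mem_finSets {W : Set (I → K)} {s : Finset (I → K)} (hs : (s : Set (I → K)) ⊆ W)
    (t₀ : I) : {t | ∀ g ∈ s, g t = g t₀} ∈ finSets W :=
  ⟨s, fun g => g t₀, hs, fun _ _ => ⟨t₀, rfl⟩, rfl⟩

theorem exists_eq_of_mem_finSets {W : Set (I → K)} {A : Set I} (hA : A ∈ finSets W) {t₀ : I}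
    (ht₀ : t₀ ∈ A) :
    ∃ s : Finset (I → K), (s : Set (I → K)) ⊆ W ∧ A = {t | ∀ g ∈ s, g t = g t₀} := by
  obtain ⟨s, v, hs, -, rfl⟩ := hA
  refine ⟨s, hs, Set.ext fun t => forall₂_congr fun g hg => ?_⟩
  rw [ht₀ g hg]

theorem inter_mem_finSets {W : Set (I → K)} {A B : Set I} (hA : A ∈ finSets W)
    (hB : B ∈ finSets W) (hne : (A ∩ B).Nonempty) : A ∩ B ∈ finSets W := by
  classical
  obtain ⟨t₀, htA, htB⟩ := hne
  obtain ⟨s, hs, rfl⟩ := exists_eq_of_mem_finSets hA htA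
  obtain ⟨s', hs', rfl⟩ := exists_eq_of_mem_finSets hB htB
  convert setOf_eq_mem_finSets (W := W) (s := s ∪ s') (by simp [hs, hs']) t₀ using 1
  ext t
  simp only [Finset.mem_union, or_imp, forall_and]
  rfl

/-- The set `B` decides `Z` modulo the filter `D`: modulo `D` it is contained in `Z` or disjoint
from `Z`. -/
def DecidesMod (D : Filter I) (B Z : Set I) : Prop :=
  (∀ᶠ t in D, t ∈ B → t ∈ Z) ∨ ∀ᶠ t in D, t ∈ B → t ∉ Z

theorem DecidesMod.mono {D : Filter I} {A B Z : Set I} (h : DecidesMod D A Z) (hBA : B ⊆ A) :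
    DecidesMod D B Z :=
  h.imp (fun h => h.mono fun _ ht hB => ht (hBA hB)) fun h => h.mono fun _ ht hB => ht (hBA hB)

theorem DecidesMod.eventually_iff {D : Filter I} {B Z : Set I} (h : DecidesMod D B Z) :
    ∀ᶠ t in D, t ∈ B → (t ∈ Z ↔ ∀ᶠ t in D, t ∈ B → t ∈ Z) := by
  by_cases hZ : ∀ᶠ t in D, t ∈ B → t ∈ Z
  · exact hZ.mono fun t ht hB => iff_of_true (ht hB) hZ
  · exact (h.resolve_left hZ).mono fun t ht hB => iff_of_false (ht hB) hZ

/-- The set `Z` is determined modulo `D` by the functions in `W`: the conditions with domain in `W`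
which decide `Z` are dense among all conditions with domain in `W`. -/
def DeterminedBy (D : Filter I) (W : Set (I → K)) (Z : Set I) : Prop :=
  ∀ A ∈ finSets W, ∃ B ∈ finSets W, B ⊆ A ∧ DecidesMod D B Z

theorem exists_subset_forall_decidesMod {ι : Type*} {D : Filter I} {W : Set (I → K)}
    (S : Finset ι) {Z : ι → Set I} (hZ : ∀ a ∈ S, DeterminedBy D W (Z a)) {A : Set I}
    (hA : A ∈ finSets W) : ∃ B ∈ finSets W, B ⊆ A ∧ ∀ a ∈ S, DecidesMod D B (Z a) := by
  classical
  induction S using Finset.induction_on with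
  | empty => exact ⟨A, hA, Subset.rfl, by simp⟩
  | insert a S ha ih =>
    obtain ⟨B, hB, hBA, hBS⟩ := ih fun b hb => hZ b (Finset.mem_insert_of_mem hb)
    obtain ⟨B', hB', hBB, hd⟩ := hZ a (Finset.mem_insert_self a S) B hB
    refine ⟨B', hB', hBB.trans hBA, fun b hb => ?_⟩
    rcases Finset.mem_insert.1 hb with rfl | hb
    · exact hd
    · exact (hBS b hb).mono hBB

end

/-! ### Good triples -/

theorem IsPreGoodTriple.frequently {I : Type u} {lam mu : Cardinal.{u}} {D : Filter I}
    {G : Set (I → mu.ord.ToType)} (h : IsPreGoodTriple lam mu D G) {A : Set I}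
    (hA : A ∈ finSets G) : ∃ᶠ t in D, t ∈ A :=
  h.nonempty_mod A hA

theorem IsRegularFilter.mono {I : Type u} {lam : Cardinal.{u}} {D D' : Filter I}
    (h : IsRegularFilter lam D) (hD : D' ≤ D) : IsRegularFilter lam D' :=
  let ⟨X, hX, hσ⟩ := h
  ⟨X, fun i => hD (hX i), hσ⟩

/-- Zorn's lemma: the union of a chain of pre-good filters is pre-good. -/
theorem IsPreGoodTriple.exists_isGoodTriple {I : Type u} {lam mu : Cardinal.{u}} {D : Filter I}
    {G : Set (I → mu.ord.ToType)} (h : IsPreGoodTriple lam mu D G) :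
    ∃ D' ≤ D, IsGoodTriple lam mu D' G := by
  obtain ⟨m, hm, hmax⟩ := @zorn_le_nonempty₀ (Filter I)ᵒᵈ _
    {D | IsPreGoodTriple lam mu (OrderDual.ofDual D) G} (fun c hc hchain y hy => by
      refine ⟨OrderDual.toDual (sInf {F : Filter I | OrderDual.toDual F ∈ c}), ?_, fun z hz => ?_⟩
      · have hdir : DirectedOn (· ≥ ·) {F : Filter I | OrderDual.toDual F ∈ c} := by
          intro a ha b hb
          rcases hchain.total ha hb with hab | hab
          · exact ⟨b, hb, hab, le_rfl⟩
          · exact ⟨a, ha, le_rfl, hab⟩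
        have hy' := hc hy
        refine ⟨hy'.aleph0_le, hy'.le, hy'.card_eq, hy'.regular.mono (sInf_le (α := Filter I) hy),
          fun A hA hmem => ?_⟩
        rw [OrderDual.ofDual_toDual, sInf_eq_iInf, mem_biInf_of_directed hdir ⟨y, hy⟩] at hmem
        obtain ⟨D', hD', hmem⟩ := hmem
        exact (hc hD').nonempty_mod A hA hmem
      · exact sInf_le (α := Filter I) hz) (OrderDual.toDual D) h
  refine ⟨OrderDual.ofDual m, hm, hmax.1, fun D' hD' hpre => le_antisymm hD' ?_⟩
  exact hmax.2 (y := OrderDual.toDual D') hpre hD'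

/-- Maximality of `D` makes the conditions dense modulo `D`: if no condition were contained in `Z`
modulo `D`, then the complement of `Z` could be added to `D`. -/
theorem IsGoodTriple.exists_finSets_subset {I : Type u} {lam mu : Cardinal.{u}} {D : Filter I}
    {G : Set (I → mu.ord.ToType)} (h : IsGoodTriple lam mu D G) {Z : Set I}
    (hZ : ∃ᶠ t in D, t ∈ Z) : ∃ A ∈ finSets G, ∀ᶠ t in D, t ∈ A → t ∈ Z := by
  by_contra! hcon
  have hpre : IsPreGoodTriple lam mu (D ⊓ 𝓟 Zᶜ) G :=
    { h.1 with
      regular := h.1.regular.mono inf_le_left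
      nonempty_mod := fun A hA hmem => by
        have hev : ∀ᶠ t in D, t ∈ Zᶜ → t ∈ Aᶜ := mem_inf_principal.1 hmem
        exact hcon A hA (hev.mono fun t ht h => ht h.2 h.1) }
  have := h.2 _ inf_le_left hpre
  exact hZ (this ▸ mem_inf_of_right (mem_principal_self Zᶜ))

theorem IsGoodTriple.determinedBy {I : Type u} {lam mu : Cardinal.{u}} {D : Filter I}
    {G : Set (I → mu.ord.ToType)} (h : IsGoodTriple lam mu D G) (Z : Set I) :
    DeterminedBy D G Z := by
  intro A hA
  by_cases hd : ∀ᶠ t in D, t ∈ A → t ∉ Z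
  · exact ⟨A, hA, Subset.rfl, Or.inr hd⟩
  have hpos : ∃ᶠ t in D, t ∈ A ∩ Z := by
    intro hev
    exact hd (hev.mono fun t ht hA hZ => ht ⟨hA, hZ⟩)
  obtain ⟨B, hB, hBZ⟩ := h.exists_finSets_subset hpos
  obtain ⟨t, htB, ht⟩ := ((h.1.frequently hB).and_eventually hBZ).exists
  exact ⟨A ∩ B, inter_mem_finSets hA hB ⟨t, (ht htB).1, htB⟩, inter_subset_left,
    Or.inl (hBZ.mono fun t ht hAB => (ht hAB.2).2)⟩

theorem mk_finSets_le {I : Type u} {mu : Cardinal.{u}} (hmu : ℵ₀ ≤ mu)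
    {W : Set (I → mu.ord.ToType)} (hW : #W ≤ mu) : #(finSets W) ≤ mu := by
  let f : List (W × mu.ord.ToType) → Set I := fun l => {t | ∀ q ∈ l, q.1.1 t = q.2}
  have hsub : finSets W ⊆ range f := by
    rintro A ⟨s, v, hs, -, rfl⟩
    refine ⟨s.attach.toList.map fun g => (⟨g.1, hs g.2⟩, v g.1), ?_⟩
    ext t
    simp only [f, List.mem_map, Finset.mem_toList]
    exact ⟨fun ht g hg => ht _ ⟨⟨g, hg⟩, Finset.mem_attach _ _, rfl⟩, by
      rintro ht _ ⟨g, -, rfl⟩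
      exact ht g.1 g.2⟩
  refine (mk_le_mk_of_subset hsub).trans (mk_range_le.trans ((mk_list_le_max _).trans ?_))
  rw [mk_prod, lift_id, lift_id, mk_ord_toType]
  exact max_le hmu ((mul_le_mul' hW le_rfl).trans (mul_eq_self hmu).le)

theorem mk_iUnion_nat_le {α : Type u} {mu : Cardinal.{u}} (hmu : ℵ₀ ≤ mu) {W : ℕ → Set α}
    (hW : ∀ n, #(W n) ≤ mu) : #(⋃ n, W n) ≤ mu := by
  have h := mk_iUnion_le_lift.{u, 0} W
  rw [lift_uzero, mk_nat, lift_aleph0] at h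
  refine h.trans ((mul_le_mul' hmu (ciSup_le' fun n => ?_)).trans (mul_eq_self hmu).le)
  simpa using hW n

/-- Every set `Z` is determined by at most `mu` functions, and by every larger set of functions. This
plays the part of the `mu⁺`-chain condition: `W` is obtained from `∅` in `ω` steps,
adding for each condition `A` with domain in the set reached so far the domain of one condition
`B ⊆ A` that decides `Z`. -/
theorem IsGoodTriple.exists_small_support {I : Type u} {lam mu : Cardinal.{u}} {D : Filter I}
    {G : Set (I → mu.ord.ToType)} (h : IsGoodTriple lam mu D G) (Z : Set I) :
    ∃ W ⊆ G, #W ≤ mu ∧ ∀ W', W ⊆ W' → W' ⊆ G → DeterminedBy D W' Z := by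
  have hmu := h.1.aleph0_le
  have hex : ∀ A : Set I, ∃ s : Finset (I → mu.ord.ToType), (s : Set (I → mu.ord.ToType)) ⊆ G ∧
      (A ∈ finSets G → ∃ B ∈ finSets (s : Set (I → mu.ord.ToType)), B ⊆ A ∧
        DecidesMod D B Z) := by
    intro A
    by_cases hA : A ∈ finSets G
    · obtain ⟨B, ⟨s, v, hs, hv, rfl⟩, hBA, hB⟩ := h.determinedBy Z A hA
      exact ⟨s, hs, fun _ => ⟨_, ⟨s, v, Subset.rfl, hv, rfl⟩, hBA, hB⟩⟩
    · exact ⟨∅, by simp, fun h => absurd h hA⟩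
  choose s hsG hs using hex
  let W : ℕ → Set (I → mu.ord.ToType) := fun n =>
    Nat.rec ∅ (fun _ V => V ∪ ⋃ A : finSets V, (s A : Set (I → mu.ord.ToType))) n
  have hWs : ∀ n, W (n + 1) = W n ∪ ⋃ A : finSets (W n), (s A : Set (I → mu.ord.ToType)) :=
    fun n => rfl
  have hWG : ∀ n, W n ⊆ G := by
    intro n
    induction n with
    | zero => exact empty_subset G
    | succ n ih => exact (hWs n).symm ▸ union_subset ih (iUnion_subset fun A => hsG A)
  have hWcard : ∀ n, #(↥(W n)) ≤ mu := by
    intro n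
    induction n with
    | zero => simp [W]
    | succ n ih =>
      rw [hWs n]
      refine (mk_union_le _ _).trans ((add_le_add ih ?_).trans (add_eq_self hmu).le)
      refine (mk_iUnion_le _).trans ((mul_le_mul' (mk_finSets_le hmu ih) ?_).trans
        (mul_eq_self hmu).le)
      exact ciSup_le' fun A => (Cardinal.lt_aleph0_of_finite _).le.trans hmu
  have hWmono : Monotone W := monotone_nat_of_le_succ fun n => (hWs n).symm ▸ subset_union_left
  refine ⟨⋃ n, W n, iUnion_subset hWG, ?_, ?_⟩
  · exact mk_iUnion_nat_le hmu hWcard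
  intro W' hWW' hW'G A hA
  obtain ⟨B, hB, hBA, hBZ⟩ := h.determinedBy Z A (finSets_mono hW'G hA)
  obtain ⟨t₀, ht₀⟩ := (h.1.frequently hB).exists
  obtain ⟨a, haW, rfl⟩ := exists_eq_of_mem_finSets hA (hBA ht₀)
  classical
  -- The part of the condition that is supported in `⋃ n, W n` already appears at a finite stage.
  let b : Finset (I → mu.ord.ToType) := a.filter (· ∈ ⋃ n, W n)
  have hb : ∃ n, (b : Set (I → mu.ord.ToType)) ⊆ W n := by
    refine hWmono.directed_le.exists_mem_subset_of_finset_subset_biUnion fun g hg => ?_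
    exact (Finset.mem_filter.1 hg).2
  obtain ⟨n, hbn⟩ := hb
  -- Here `B'` has its domain in `⋃ n, W n` and decides `Z`. It extends the part of `a` inside
  -- `⋃ n, W n`, so it is compatible with all of `a`.
  have hA' := setOf_eq_mem_finSets hbn t₀
  obtain ⟨B', hB', hBA', hd⟩ := hs _ (finSets_mono (hWG n) hA')
  have hsub : (s {t | ∀ g ∈ b, g t = g t₀} : Set (I → mu.ord.ToType)) ⊆ ⋃ n, W n :=
    (subset_iUnion (fun A : finSets (W n) => (s A : Set (I → mu.ord.ToType))) ⟨_, hA'⟩).trans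
      ((subset_union_right.trans (hWs n).ge).trans (subset_iUnion W (n + 1)))
  have hne : (B' ∩ {t | ∀ g ∈ a, g t = g t₀}).Nonempty := by
    obtain ⟨t₁, ht₁⟩ := (h.1.frequently
      (finSets_mono (hsub.trans (iUnion_subset hWG)) hB')).exists
    obtain ⟨a', ha', rfl⟩ := exists_eq_of_mem_finSets hB' ht₁
    have hmem : {t | ∀ g ∈ a ∪ a', g t = if g ∈ a then g t₀ else g t₁} ∈ finSets G := by
      refine ⟨a ∪ a', fun g => if g ∈ a then g t₀ else g t₁, ?_, fun g _ => ?_, rfl⟩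
      · rw [Finset.coe_union]
        exact union_subset (haW.trans hW'G) ((ha'.trans hsub).trans (iUnion_subset hWG))
      · dsimp only
        split_ifs
        exacts [⟨t₀, rfl⟩, ⟨t₁, rfl⟩]
    obtain ⟨t, ht⟩ := (h.1.frequently hmem).exists
    refine ⟨t, fun g hg => ?_, fun g hg => ?_⟩
    · have hgt := ht g (Finset.mem_union_right a hg)
      split_ifs at hgt with hga
      · rw [hgt]
        exact (hBA' ht₁ g (Finset.mem_filter.2 ⟨hga, hsub (ha' hg)⟩)).symm
      · exact hgt
    · simpa [hg] using ht g (Finset.mem_union_left a' hg)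
  exact ⟨_, inter_mem_finSets (finSets_mono (hsub.trans hWW') hB') hA hne,
    inter_subset_right, hd.mono inter_subset_left⟩

/-! ### Fooling sets of natural numbers -/

section

variable {I K : Type*}

/-- The set of all `t` at which `x` and `y` are different but are not separated by `c`. -/
def foolSet (x y : I → ℕ) (c : I → Set ℕ) : Set I :=
  {t | x t ≠ y t ∧ (x t ∈ c t ↔ y t ∈ c t)}

/-- One step of the construction. Let `F` be a function outside `W` that takes every value coding a
pair of natural numbers, `x` and `y` being the two components of `F`. A condition with domain in `W`
can be extended, using one value of `F`, so that `(x, y)` fools finitely many functions `c`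
determined by `W`. -/
theorem exists_finSets_insert_subset_foolSet {D : Filter I} {W : Set (I → K)} {F : I → K}
    (hFW : F ∉ W) {e : ℕ × ℕ → K} {d : K → ℕ × ℕ} (hde : ∀ p, d (e p) = p)
    (heF : ∀ p, e p ∈ range F) (C : Finset (I → Set ℕ))
    (hC : ∀ c ∈ C, ∀ n, DeterminedBy D W {t | n ∈ c t}) {A : Set I} (hA : A ∈ finSets W) :
    ∃ B ∈ finSets (insert F W), B ⊆ A ∧ ∀ c ∈ C, ∀ᶠ t in D, t ∈ B →
      t ∈ foolSet (fun t => (d (F t)).1) (fun t => (d (F t)).2) c := by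
  classical
  obtain ⟨B, ⟨s, v, hs, hv, rfl⟩, hBA, hdec⟩ := exists_subset_forall_decidesMod
    (C ×ˢ Finset.range (2 ^ C.card + 1)) (Z := fun a => {t | a.2 ∈ a.1 t})
    (fun a ha => hC a.1 (Finset.mem_product.1 ha).1 a.2) hA
  let B : Set I := {t | ∀ g ∈ s, g t = v g}
  -- Two of `2 ^ #C + 1` numbers lie in the same members of `C`, as far as `B` decides.
  obtain ⟨m, hm, n, hn, hmn, hτ⟩ := Finset.exists_ne_map_eq_of_card_lt_of_maps_to
    (s := Finset.range (2 ^ C.card + 1)) (t := C.powerset)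
    (f := fun n => C.filter fun c => ∀ᶠ t in D, t ∈ B → n ∈ c t)
    (by simp) (fun n _ => Finset.mem_coe.2 (Finset.mem_powerset.2 (Finset.filter_subset _ _)))
  have hupd : ∀ g ∈ s, Function.update v F (e (m, n)) g = v g := fun g hg =>
    Function.update_of_ne (ne_of_mem_of_not_mem (hs hg) hFW) _ _
  refine ⟨{t | ∀ g ∈ insert F s, g t = Function.update v F (e (m, n)) g},
    ⟨insert F s, _, ?_, ?_, rfl⟩, ?_, fun c hc => ?_⟩
  · rw [Finset.coe_insert]
    exact insert_subset_insert hs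
  · intro g hg
    rcases Finset.mem_insert.1 hg with rfl | hg
    · simpa using heF (m, n)
    · exact hupd g hg ▸ hv g hg
  · refine fun t ht => hBA fun g hg => ?_
    rw [ht g (Finset.mem_insert_of_mem hg), hupd g hg]
  · have hm' := (hdec (c, m) (Finset.mk_mem_product hc hm)).eventually_iff
    have hn' := (hdec (c, n) (Finset.mk_mem_product hc hn)).eventually_iff
    have hiff : (∀ᶠ t in D, t ∈ B → m ∈ c t) ↔ ∀ᶠ t in D, t ∈ B → n ∈ c t := by
      simpa [hc] using Finset.ext_iff.1 hτ c
    filter_upwards [hm', hn'] with t htm htn ht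
    have htB : t ∈ B := fun g hg => by
      rw [ht g (Finset.mem_insert_of_mem hg), hupd g hg]
    have hFt : F t = e (m, n) := by simpa using ht F (Finset.mem_insert_self F s)
    refine ⟨by simpa [hFt, hde] using hmn, ?_⟩
    simp only [hFt, hde]
    exact (htm htB).trans (hiff.trans (htn htB).symm)

/-- The previous lemma, applied along a finite set `S` of indices in increasing order. -/
theorem exists_finSets_subset_forall_foolSet {J : Type*} [LinearOrder J] {D : Filter I}
    {G : Set (I → K)} {F : J → I → K} (hF : Function.Injective F) (hFG : ∀ j, F j ∉ G)
    {e : ℕ × ℕ → K} {d : K → ℕ × ℕ} (hde : ∀ p, d (e p) = p) (heF : ∀ j p, e p ∈ range (F j))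
    (C : J → Finset (I → Set ℕ))
    (hC : ∀ j, ∀ c ∈ C j, ∀ n, DeterminedBy D (G ∪ F '' Iio j) {t | n ∈ c t})
    {A : Set I} (hA : A ∈ finSets G) (S : Finset J) :
    ∃ B ∈ finSets (G ∪ F '' {i | ∃ j ∈ S, i ≤ j}), B ⊆ A ∧ ∀ j ∈ S, ∀ c ∈ C j, ∀ᶠ t in D,
      t ∈ B → t ∈ foolSet (fun t => (d (F j t)).1) (fun t => (d (F j t)).2) c := by
  induction S using Finset.induction_on_max with
  | empty => exact ⟨A, finSets_mono subset_union_left hA, Subset.rfl, by simp⟩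
  | insert j S hj ih =>
    obtain ⟨B, hB, hBA, hBS⟩ := ih
    have hsub : G ∪ F '' {i | ∃ j ∈ S, i ≤ j} ⊆ G ∪ F '' Iio j :=
      union_subset_union_right _ (image_mono fun i ⟨k, hk, hik⟩ => hik.trans_lt (hj k hk))
    have hFj : F j ∉ G ∪ F '' Iio j := by
      rintro (h | ⟨i, hi, h⟩)
      · exact hFG j h
      · exact hi.ne (hF h)
    obtain ⟨B', hB', hBB, hfool⟩ := exists_finSets_insert_subset_foolSet hFj hde (heF j) (C j)
      (hC j) (finSets_mono hsub hB)
    refine ⟨B', finSets_mono ?_ hB', hBB.trans hBA, fun k hk c hc => ?_⟩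
    · refine insert_subset (Or.inr ⟨j, ⟨j, Finset.mem_insert_self j S, le_rfl⟩, rfl⟩) ?_
      exact union_subset_union_right _
        (image_mono fun i hi => ⟨j, Finset.mem_insert_self j S, (mem_Iio.1 hi).le⟩)
    · rcases Finset.mem_insert.1 hk with rfl | hk
      · exact hfool c hc
      · exact (hBS k hk c hc).mono fun t ht hB => ht (hBB hB)

end

/-! ### Independent functions -/

/-- There are `2 ^ #T` independent functions on an infinite set `T`. The points of `T` are taken to
code pairs `(E, φ)` of a finite set `E ⊆ T` and a function `φ` on finite subsets of `T`; the function
belonging to `a ⊆ T` maps `(E, φ)` to `φ (E ∩ a)`. -/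
theorem exists_independent_family {T J : Type u} [Infinite T] (hJ : #J ≤ #(Set T)) :
    ∃ f : J → T → ℕ × ℕ, ∀ (s : Finset J) (v : J → ℕ × ℕ), ∃ p, ∀ j ∈ s, f j p = v j := by
  classical
  obtain ⟨a⟩ := hJ
  have hP : #(Finset T × (Finset T →₀ ℕ)) = #T := by
    simp [mk_finset_of_infinite]
  obtain ⟨r⟩ := Cardinal.eq.1 hP
  refine ⟨fun j p => Nat.unpair ((r.symm p).2 ((r.symm p).1.filter (· ∈ a j))), fun s v => ?_⟩
  -- A finite set which tells the sets `a j`, `j ∈ s`, apart.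
  have hsep : ∀ i j, ∃ q, i ≠ j → ¬(q ∈ a i ↔ q ∈ a j) := by
    intro i j
    by_contra! h
    obtain ⟨q⟩ := (inferInstance : Nonempty T)
    exact (h q).1 (a.injective (Set.ext fun q => (h q).2))
  choose q hq using hsep
  let E : Finset T := (s ×ˢ s).image fun p => q p.1 p.2
  let tr : J → Finset T := fun j => E.filter (· ∈ a j)
  have htr : ∀ i ∈ s, ∀ j ∈ s, tr i = tr j → i = j := by
    intro i hi j hj hij
    by_contra hne
    have hqE : q i j ∈ E := Finset.mem_image.2 ⟨(i, j), Finset.mk_mem_product hi hj, rfl⟩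
    apply hq i j hne
    simpa [tr, hqE] using Finset.ext_iff.1 hij (q i j)
  refine ⟨r (E, ∑ j ∈ s, Finsupp.single (tr j) (Nat.pair (v j).1 (v j).2)), fun j hj => ?_⟩
  simp only [Equiv.symm_apply_apply, Finsupp.finsetSum_apply]
  rw [Finset.sum_eq_single_of_mem j hj]
  · simp [tr]
  · intro i hi hij
    exact Finsupp.single_eq_of_ne fun h => hij (htr i hi j hj h.symm)

/-! ### The filter -/

/-- The cardinal `mu⁺` is regular: a set of at most `mu` indices is bounded. -/
theorem exists_forall_lt_of_mk_le {mu : Cardinal.{u}} (hmu : ℵ₀ ≤ mu)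
    {S : Set (Order.succ mu).ord.ToType} (hS : #S ≤ mu) : ∃ j, ∀ i ∈ S, i < j := by
  by_contra! h
  have hcov : (univ : Set (Order.succ mu).ord.ToType) ⊆ ⋃ i : S, insert i.1 (Iio i.1) := by
    intro j _
    obtain ⟨i, hi, hji⟩ := h j
    exact mem_iUnion.2 ⟨⟨i, hi⟩, hji.eq_or_lt.imp id id⟩
  have hle : ∀ i : (Order.succ mu).ord.ToType, #(insert i (Iio i) : Set _) ≤ mu := fun i => by
    refine mk_insert_le.trans ?_
    have hi : #(Iio i) ≤ mu := Order.lt_succ_iff.1 (by simpa using mk_Iio_lt i (by simp))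
    exact (add_le_add hi (one_le_aleph0.trans hmu)).trans (add_eq_self hmu).le
  have hcard := (mk_le_mk_of_subset hcov).trans (mk_iUnion_le _)
  rw [mk_univ, mk_ord_toType] at hcard
  refine (Order.lt_succ mu).not_ge (hcard.trans ?_)
  exact (mul_le_mul' hS (ciSup_le' fun i : S => hle i.1)).trans (mul_eq_self hmu).le

/-- Given a good triple `(I, D, G ∪ {F j : j < mu⁺})`, with `x j` and `y j` the two components of
`F j`, let `D'` be the filter generated by `D` and the sets `foolSet (x j) (y j) c`, where `c` is
determined by `G` and the functions `F i`, `i < j`. It is pre-good for `G`, and every `c` whatsoever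
is fooled at some `j`, since `c` is determined by `mu` functions. -/
theorem IsGoodTriple.exists_fooling {I : Type u} {lam mu : Cardinal.{u}} {D : Filter I}
    {G : Set (I → mu.ord.ToType)} {F : (Order.succ mu).ord.ToType → I → mu.ord.ToType}
    (hF : Function.Injective F) (hFG : ∀ j, F j ∉ G)
    {e : ℕ × ℕ → mu.ord.ToType} {d : mu.ord.ToType → ℕ × ℕ} (hde : ∀ p, d (e p) = p)
    (heF : ∀ j, range (F j) = range e) (hgood : IsGoodTriple lam mu D (G ∪ range F)) :
    ∃ D' ≤ D, IsPreGoodTriple lam mu D' G ∧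
      (∀ c : I → Set ℕ, ∃ j, ∀ᶠ t in D',
        t ∈ foolSet (fun t => (d (F j t)).1) (fun t => (d (F j t)).2) c) ∧
      ∀ i j, ∀ᶠ t in D', (d (F i t)).1 ≠ (d (F j t)).2 := by
  classical
  let Φ := {q : (Order.succ mu).ord.ToType × (I → Set ℕ) //
    ∀ n, DeterminedBy D (G ∪ F '' Iio q.1) {t | n ∈ q.2 t}}
  let E : Φ → Set I := fun q =>
    foolSet (fun t => (d (F q.1.1 t)).1) (fun t => (d (F q.1.1 t)).2) q.1.2
  have hE : ∀ q, ∀ᶠ t in D ⊓ ⨅ q, 𝓟 (E q), t ∈ E q := fun q =>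
    mem_inf_of_right (mem_iInf_of_mem q (mem_principal_self _))
  refine ⟨D ⊓ ⨅ q, 𝓟 (E q), inf_le_left, ?_, ?_, ?_⟩
  · refine { hgood.1 with
      regular := hgood.1.regular.mono inf_le_left
      nonempty_mod := fun A hA hmem => ?_ }
    obtain ⟨T, hT, U, hU, hTU⟩ := mem_inf_iff.1 hmem
    obtain ⟨Q, hQ⟩ := (mem_iInf_finite _).1 hU
    rw [iInf_principal_finset, mem_principal] at hQ
    let C : (Order.succ mu).ord.ToType → Finset (I → Set ℕ) := fun j =>
      (Q.filter fun q => q.1.1 = j).image fun q => q.1.2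
    obtain ⟨B, hB, hBA, hfool⟩ := exists_finSets_subset_forall_foolSet (D := D) hF hFG hde
      (fun j p => heF j ▸ mem_range_self p) C (by
        intro j c hc
        obtain ⟨q, hq, rfl⟩ := Finset.mem_image.1 hc
        obtain ⟨-, rfl⟩ := Finset.mem_filter.1 hq
        exact q.2) hA (Q.image fun q => q.1.1)
    have hB' : B ∈ finSets (G ∪ range F) :=
      finSets_mono (union_subset_union_right _ (image_subset_range _ _)) hB
    have hall : ∀ᶠ t in D, ∀ q ∈ Q, t ∈ B → t ∈ E q := by
      rw [eventually_all_finset]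
      intro q hq
      exact hfool q.1.1 (Finset.mem_image_of_mem _ hq) q.1.2
        (Finset.mem_image.2 ⟨q, Finset.mem_filter.2 ⟨hq, rfl⟩, rfl⟩)
    obtain ⟨t, htB, htT, ht⟩ := ((hgood.1.frequently hB').and_eventually
      ((show ∀ᶠ t in D, t ∈ T from hT).and hall)).exists
    have htU : t ∈ U := hQ (mem_iInter₂.2 fun q hq => ht q hq htB)
    exact (hTU.symm ▸ ⟨htT, htU⟩ : t ∈ Aᶜ) (hBA htB)
  · intro c
    have hmu := hgood.1.aleph0_le
    choose W hWG hW hdet using fun n : ℕ => hgood.exists_small_support {t | n ∈ c t}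
    have hS : #(F ⁻¹' ⋃ n, W n) ≤ mu :=
      (mk_preimage_of_injective F _ hF).trans (mk_iUnion_nat_le hmu hW)
    obtain ⟨j, hj⟩ := exists_forall_lt_of_mk_le hmu hS
    refine ⟨j, hE ⟨(j, c), fun n => hdet n _ ?_ ?_⟩⟩
    · intro g hg
      rcases hWG n hg with hgG | ⟨i, rfl⟩
      · exact Or.inl hgG
      · exact Or.inr ⟨i, hj i (mem_iUnion.2 ⟨n, hg⟩), rfl⟩
    · exact union_subset_union_right _ (image_subset_range _ _)
  · -- The functions `x i` and `y i` are determined by `F i`, hence singletons `c = {x i}` and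
    -- `c = {y i}` are fooled at every `j > i`, which keeps all the `x i` apart from all the `y j`.
    -- The value of `F i` is decided by every condition with `F i` in its domain.
    have hFdet : ∀ (r : ℕ × ℕ → ℕ) (i j), i < j → ∀ n,
        DeterminedBy D (G ∪ F '' Iio j) {t | n ∈ ({r (d (F i t))} : Set ℕ)} := by
      intro r i j hij n A hA
      have hA' := finSets_mono
        (union_subset_union_right G (image_subset_range F (Iio j))) hA
      obtain ⟨t₀, ht₀⟩ := (hgood.1.frequently hA').exists
      have hsing : {t | ∀ g ∈ ({F i} : Finset _), g t = g t₀} ∈ finSets (G ∪ F '' Iio j) :=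
        setOf_eq_mem_finSets (by simpa using Or.inr ⟨i, hij, rfl⟩) t₀
      refine ⟨_, inter_mem_finSets hA hsing ⟨t₀, ht₀, by simp⟩, inter_subset_left, ?_⟩
      by_cases hn : n = r (d (F i t₀))
      · refine Or.inl (Eventually.of_forall fun t ht => ?_)
        have : F i t = F i t₀ := ht.2 _ (Finset.mem_singleton_self _)
        simp [this, hn]
      · refine Or.inr (Eventually.of_forall fun t ht => ?_)
        have : F i t = F i t₀ := ht.2 _ (Finset.mem_singleton_self _)
        simp [this, hn]
    intro i j
    rcases lt_trichotomy i j with hij | rfl | hij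
    · filter_upwards [hE ⟨(j, fun t => {(d (F i t)).1}), hFdet Prod.fst i j hij⟩] with t ht heq
      exact ht.1 ((ht.2.2 heq.symm).trans heq)
    · filter_upwards [hE ⟨(i, fun _ => ∅), fun n A hA => ⟨A, hA, Subset.rfl, Or.inr (by simp)⟩⟩]
        with t ht
      exact ht.1
    · filter_upwards [hE ⟨(i, fun t => {(d (F j t)).2}), hFdet Prod.snd j i hij⟩] with t ht heq
      exact ht.1 (heq.trans (ht.2.1 heq).symm)

/-- The function `gstar` is traded for the `mu⁺` functions `e ∘ f j ∘ gstar`, where `e` codes pairs of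
natural numbers and the `f j` are independent: any finite number of values of these functions is
implied by a single value of `gstar`. -/
theorem IsGoodTriple.exists_isGoodTriple_fooling {I : Type u} {lam mu : Cardinal.{u}}
    {D₀ : Filter I} {G : Set (I → mu.ord.ToType)} {gstar : I → mu.ord.ToType}
    (hgstar : gstar ∉ G) (hgood : IsGoodTriple lam mu D₀ (insert gstar G))
    (hrange : Set.range gstar = Set.univ) :
    ∃ D ≤ D₀, IsGoodTriple lam mu D G ∧ ∃ x y : (Order.succ mu).ord.ToType → I → ℕ,
      (∀ c : I → Set ℕ, ∃ j, ∀ᶠ t in D, t ∈ foolSet (x j) (y j) c) ∧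
      ∀ i j, ∀ᶠ t in D, x i t ≠ y j t := by
  classical
  have hmu := hgood.1.aleph0_le
  have : Infinite mu.ord.ToType := by rwa [infinite_iff, mk_ord_toType]
  obtain ⟨f, hf⟩ := exists_independent_family (T := mu.ord.ToType)
    (J := (Order.succ mu).ord.ToType) (by
      rw [mk_ord_toType, mk_set, mk_ord_toType]
      exact Order.succ_le_of_lt (cantor mu))
  let e : ℕ × ℕ → mu.ord.ToType := fun p => Infinite.natEmbedding _ (Nat.pairEquiv p)
  have he : Function.Injective e :=
    (Infinite.natEmbedding mu.ord.ToType).injective.comp Nat.pairEquiv.injective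
  let F : (Order.succ mu).ord.ToType → I → mu.ord.ToType := fun j t => e (f j (gstar t))
  have hF : ∀ (s : Finset (Order.succ mu).ord.ToType) (w : _ → ℕ × ℕ),
      ∃ p, ∀ t, gstar t = p → ∀ j ∈ s, F j t = e (w j) := by
    intro s w
    obtain ⟨p, hp⟩ := hf s w
    exact ⟨p, fun t ht j hj => by simp only [F, ht, hp j hj]⟩
  have hsurj : ∀ p, ∃ t, gstar t = p := range_eq_univ.1 hrange
  have hFinj : Function.Injective F := by
    intro i j hij
    by_contra hne
    obtain ⟨p, hp⟩ := hF {i, j} fun k => if k = i then (0, 0) else (0, 1)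
    obtain ⟨t, ht⟩ := hsurj p
    have h1 := hp t ht i (by simp)
    have h2 := hp t ht j (by simp)
    rw [← hij, h1, if_pos rfl, if_neg (Ne.symm hne)] at h2
    simpa using he h2
  have hFrange : ∀ j, range (F j) = range e := by
    intro j
    refine Subset.antisymm (range_subset_iff.2 fun t => mem_range_self _) ?_
    rintro _ ⟨w, rfl⟩
    obtain ⟨p, hp⟩ := hF {j} fun _ => w
    obtain ⟨t, ht⟩ := hsurj p
    exact ⟨t, hp t ht j (by simp)⟩
  -- If `F j` were in `G`, then `gstar` and `F j` could be given contradictory values.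
  have hFG : ∀ j, F j ∉ G := by
    intro j hj
    obtain ⟨p, hp⟩ := hF {j} fun _ => (0, 0)
    have hne : F j ≠ gstar := fun h => hgstar (h ▸ hj)
    have hmem : {t | ∀ g ∈ ({F j, gstar} : Finset _),
        g t = if g = gstar then p else e (0, 1)} ∈ finSets (insert gstar G) := by
      refine ⟨_, _, ?_, ?_, rfl⟩
      · simp [insert_subset_iff, hj]
      · intro g hg
        rcases Finset.mem_insert.1 hg with rfl | hg
        · rw [if_neg hne, hFrange]
          exact mem_range_self _
        · rw [Finset.mem_singleton.1 hg, if_pos rfl, hrange]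
          exact mem_univ _
    obtain ⟨t, ht⟩ := (hgood.1.frequently hmem).exists
    have h1 := ht (F j) (by simp)
    have h2 := ht gstar (by simp)
    rw [if_neg hne, hp t (by simpa using h2) j (by simp)] at h1
    simpa using he h1
  have hpre : IsPreGoodTriple lam mu D₀ (G ∪ range F) := by
    refine { hgood.1 with nonempty_mod := ?_ }
    rintro A ⟨s, v, hs, hv, rfl⟩ hmem
    have hw : ∀ j, ∃ w, F j ∈ s → e w = v (F j) := by
      intro j
      by_cases hj : F j ∈ s
      · obtain ⟨w, hw⟩ := hFrange j ▸ hv _ hj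
        exact ⟨w, fun _ => hw⟩
      · exact ⟨0, fun h => absurd h hj⟩
    choose w hw using hw
    obtain ⟨p, hp⟩ := hF (s.preimage F hFinj.injOn) w
    refine hgood.1.nonempty_mod {t | ∀ g ∈ insert gstar (s.filter (· ∈ G)),
      g t = Function.update v gstar p g} ⟨_, _, ?_, ?_, rfl⟩
        (mem_of_superset hmem (compl_subset_compl.2 ?_))
    · intro g hg
      rcases Finset.mem_insert.1 hg with rfl | hg
      · exact mem_insert _ _
      · exact Or.inr (Finset.mem_filter.1 hg).2
    · intro g hg
      by_cases hgs : g = gstar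
      · rw [hgs, hrange]
        exact mem_univ _
      · rw [Function.update_of_ne hgs]
        exact hv g (Finset.mem_filter.1 ((Finset.mem_insert.1 hg).resolve_left hgs)).1
    · intro t ht g hg
      rcases hs hg with hgG | ⟨j, rfl⟩
      · have := ht g (Finset.mem_insert_of_mem (Finset.mem_filter.2 ⟨hg, hgG⟩))
        rwa [Function.update_of_ne (ne_of_mem_of_not_mem hgG hgstar)] at this
      · rw [← hw j hg]
        refine hp t ?_ j (Finset.mem_preimage.2 hg)
        simpa using ht gstar (Finset.mem_insert_self _ _)
  -- `D₁` is maximal for `G ∪ range F`, then `D₂` is pre-good and `D` maximal for `G` alone.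
  obtain ⟨D₁, hD₁, hgood₁⟩ := hpre.exists_isGoodTriple
  obtain ⟨D₂, hD₂, hpre₂, hfool, hne⟩ := hgood₁.exists_fooling hFinj hFG
    (d := Function.invFun e) (Function.leftInverse_invFun he) hFrange
  obtain ⟨D, hD, hgoodD⟩ := hpre₂.exists_isGoodTriple
  exact ⟨D, hD.trans (hD₂.trans hD₁), hgoodD, _, _,
    fun c => (hfool c).imp fun j hj => hj.filter_mono hD, fun i j => (hne i j).filter_mono hD⟩

/-! ### Ultrapowers of the random graph -/

theorem infinite_of_model_randomGraphTheory {M : Type v} [Language.graph.Structure M]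
    (hM : M ⊨ randomGraphTheory) : Infinite M := by
  refine ⟨fun hfin => ?_⟩
  obtain ⟨n, ⟨r⟩⟩ := Finite.exists_equiv_fin M
  obtain ⟨z, -, hz⟩ := (model_randomGraphTheory_iff.1 hM).2 0 n Fin.elim0 r.symm fun i => i.elim0
  exact (hz (r z)).1 (r.symm_apply_apply z).symm

theorem ultrapower_models {I : Type u} {M : Type v} [Language.graph.Structure M] [Nonempty M]
    {T : Language.graph.Theory} (hM : M ⊨ T) (D : Ultrafilter I) : Ultrapower M D ⊨ T := by
  rw [Language.Theory.model_iff] at hM ⊢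
  intro φ hφ
  exact (Language.Ultraproduct.sentence_realize φ).2 (Eventually.of_forall fun _ => hM φ hφ)

theorem relMap_adj_ultrapower_iff {I : Type u} {M : Type v} [Language.graph.Structure M]
    [Nonempty M] {D : Ultrafilter I} (b c : I → M) :
    Language.Structure.RelMap Language.adj
      ![(Quotient.mk'' b : Ultrapower M D), (Quotient.mk'' c : Ultrapower M D)] ↔
      ∀ᶠ t in (D : Filter I), Language.Structure.RelMap Language.adj ![b t, c t] := by
  have h := Language.Ultraproduct.realize_formula_cast (u := D) (M := fun _ => M)
    (Language.adj.formula₂ (Language.var 0) (Language.var 1)) ![b, c]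
  simp only [Language.Formula.realize_rel₂, Language.Term.realize_var] at h
  exact h

theorem exists_adj_of_model_randomGraphTheory {N : Type v} [Language.graph.Structure N]
    (hN : N ⊨ randomGraphTheory) (S T : Finset N) (hST : Disjoint S T) :
    ∃ z : N, (∀ a ∈ S, Language.Structure.RelMap Language.adj ![z, a]) ∧
      ∀ a ∈ T, ¬ Language.Structure.RelMap Language.adj ![z, a] := by
  obtain ⟨z, h1, h2⟩ := (model_randomGraphTheory_iff.1 hN).2 _ _
    (fun i => (S.equivFin.symm i : N)) (fun i => (T.equivFin.symm i : N))
    (fun i j => Finset.disjoint_iff_ne.1 hST _ (S.equivFin.symm i).2 _ (T.equivFin.symm j).2)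
  exact ⟨z, fun a ha => by simpa using (h1 (S.equivFin ⟨a, ha⟩)).2,
    fun a ha => by simpa using (h2 (T.equivFin ⟨a, ha⟩)).2⟩

/-- In a saturated model of the theory of the random graph, small disjoint sets of vertices are
separated by a vertex. -/
theorem IsSaturatedStructure.exists_adj {N : Type v} [Language.graph.Structure N]
    {κ : Cardinal.{u}} (hsat : IsSaturatedStructure Language.graph N κ)
    (hN : N ⊨ randomGraphTheory) {A B : Set N} (hAB : Disjoint A B)
    (hcard : lift.{u} #(A ∪ B : Set N) < lift.{v} κ) :
    ∃ z : N, (∀ a ∈ A, Language.Structure.RelMap Language.adj ![z, a]) ∧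
      ∀ a ∈ B, ¬ Language.Structure.RelMap Language.adj ![z, a] := by
  classical
  let R : (A ∪ B : Set N) → Language.graph[[(A ∪ B : Set N)]].Formula (Fin 1) := fun a =>
    Language.Relations.formula₂
      ((Language.graph.lhomWithConstants (A ∪ B : Set N)).onRelation Language.adj)
      (Language.Term.var 0) (Language.Constants.term (Language.graph.con a))
  have hR : ∀ a b, (R a).Realize (fun _ : Fin 1 => b) ↔
      Language.Structure.RelMap Language.adj ![b, a.1] := by
    intro a b
    simp only [R, Language.Formula.realize_rel₂, Language.Term.realize_var,
      Language.Term.realize_con]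
    exact iff_of_eq (Language.LHom.map_onRelation _ _ _)
  obtain ⟨b, hb⟩ := hsat (A ∪ B) hcard
    ({φ | ∃ a, a.1 ∈ A ∧ φ = R a} ∪ {φ | ∃ a, a.1 ∈ B ∧ φ = (R a).not}) (by
      intro q hq
      have hex : ∀ φ : q, ∃ a : (A ∪ B : Set N),
          (a.1 ∈ A ∧ φ.1 = R a) ∨ (a.1 ∈ B ∧ φ.1 = (R a).not) := fun φ => by
        rcases hq φ.2 with ⟨a, ha⟩ | ⟨a, ha⟩
        exacts [⟨a, Or.inl ha⟩, ⟨a, Or.inr ha⟩]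
      choose par hpar using hex
      let S : Finset N := Finset.univ.image fun φ => (par φ).1
      have hS : ∀ φ, (par φ).1 ∈ S := fun φ => Finset.mem_image_of_mem _ (Finset.mem_univ φ)
      obtain ⟨z, hzA, hzB⟩ := exists_adj_of_model_randomGraphTheory hN
        (S.filter (· ∈ A)) (S.filter (· ∈ B)) (Finset.disjoint_left.2 fun b hbA hbB =>
          Set.disjoint_left.1 hAB (Finset.mem_filter.1 hbA).2 (Finset.mem_filter.1 hbB).2)
      refine ⟨z, fun φ hφ => ?_⟩
      rcases hpar ⟨φ, hφ⟩ with ⟨ha, h⟩ | ⟨ha, h⟩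
      · rw [show φ = _ from h, hR]
        exact hzA _ (Finset.mem_filter.2 ⟨hS _, ha⟩)
      · rw [show φ = _ from h, Language.Formula.realize_not, hR]
        exact hzB _ (Finset.mem_filter.2 ⟨hS _, ha⟩))
  refine ⟨b, fun a ha => ?_, fun a ha => ?_⟩
  · exact (hR ⟨a, Or.inl ha⟩ b).1 (hb _ (Or.inl ⟨_, ha, rfl⟩))
  · have := hb _ (Or.inr ⟨⟨a, Or.inr ha⟩, ha, rfl⟩)
    rwa [Language.Formula.realize_not, hR] at this

/-- If every `c` is fooled by some pair `(x j, y j)`, then the vertices named by the `x j` cannot be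
separated in the ultrapower from those named by the `y j`: to a vertex, represented by `b : I → M`,
corresponds the function `c` which maps `t` to the set of neighbours of `b t` in a fixed copy of `ℕ`
inside `M`. -/
theorem not_isSaturatedStructure_ultrapower {I J : Type u} {D : Ultrafilter I} {x y : J → I → ℕ}
    (hfool : ∀ c : I → Set ℕ, ∃ j, ∀ᶠ t in (D : Filter I), t ∈ foolSet (x j) (y j) c)
    (hne : ∀ i j, ∀ᶠ t in (D : Filter I), x i t ≠ y j t)
    {M : Type v} [Language.graph.Structure M] (hM : M ⊨ randomGraphTheory) {κ : Cardinal.{u}}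
    (hJ : #J < κ) (hκ : ℵ₀ ≤ κ) : ¬ IsSaturatedStructure Language.graph (Ultrapower M D) κ := by
  intro hsat
  have := infinite_of_model_randomGraphTheory hM
  let a : ℕ ↪ M := Infinite.natEmbedding M
  let p (w : J → I → ℕ) (j : J) : Ultrapower M D := Quotient.mk'' fun t => a (w j t)
  have hdisj : Disjoint (range (p x)) (range (p y)) := by
    rw [Set.disjoint_left]
    rintro _ ⟨i, rfl⟩ ⟨j, hij⟩
    have heq : ∀ᶠ t in (D : Filter I), a (y j t) = a (x i t) := Quotient.eq''.1 hij
    obtain ⟨t, h1, h2⟩ := (heq.and (hne i j)).exists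
    exact h2 (a.injective h1).symm
  have hcard : lift.{u} #(range (p x) ∪ range (p y) : Set (Ultrapower M D)) <
      lift.{max u v} κ := by
    have hr : ∀ w, lift.{u} #(range (p w)) < lift.{max u v} κ := fun w => by
      refine (mk_range_le_lift (f := p w)).trans_lt ?_
      exact lift_lt.2 hJ
    refine (lift_le.2 (mk_union_le _ _)).trans_lt ?_
    rw [lift_add]
    exact add_lt_of_lt (by simpa using hκ) (hr x) (hr y)
  obtain ⟨z, hz1, hz2⟩ := hsat.exists_adj (ultrapower_models hM D) hdisj hcard
  induction z using Quotient.inductionOn' with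
  | h c =>
  obtain ⟨j, hj⟩ := hfool fun t => {n | Language.Structure.RelMap Language.adj ![c t, a n]}
  refine hz2 _ ⟨j, rfl⟩ ((relMap_adj_ultrapower_iff c _).2 ?_)
  filter_upwards [hj, (relMap_adj_ultrapower_iff c _).1 (hz1 _ ⟨j, rfl⟩)] with t ht h
  exact ht.2.1 h

theorem theorem6p1 {I : Type u} (lam mu : Cardinal.{u}) (D₀ : Filter I)
    (G : Set (I → mu.ord.ToType)) (gstar : I → mu.ord.ToType)
    (hgstar : gstar ∉ G)
    (hgood : IsGoodTriple lam mu D₀ (insert gstar G))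
    (hmu : Order.succ mu < lam)
    (hrange : Set.range gstar = Set.univ) :
    ∃ D : Filter I, D ≤ D₀ ∧ IsGoodTriple lam mu D G ∧
      ∀ Dstar : Ultrafilter I, (Dstar : Filter I) ≤ D →
        ∀ (M : Type v) [Language.graph.Structure M], M ⊨ randomGraphTheory →
          ¬ IsSaturatedStructure Language.graph (Ultrapower M Dstar)
              (Order.succ (Order.succ mu)) ∧
          ¬ IsSaturatedStructure Language.graph (Ultrapower M Dstar) (Order.succ lam) := by
  obtain ⟨D, hD, hgoodD, x, y, hfool, hne⟩ := hgood.exists_isGoodTriple_fooling hgstar hrange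
  refine ⟨D, hD, hgoodD, fun Dstar hDstar M _ hM => ?_⟩
  have hsat : ∀ κ : Cardinal.{u}, Order.succ mu < κ →
      ¬ IsSaturatedStructure Language.graph (Ultrapower M Dstar) κ := fun κ hκ =>
    not_isSaturatedStructure_ultrapower
      (fun c => (hfool c).imp fun j hj => hj.filter_mono hDstar)
      (fun i j => (hne i j).filter_mono hDstar) hM (by rwa [mk_ord_toType])
      (hgood.1.aleph0_le.trans ((Order.le_succ mu).trans hκ.le))
  exact ⟨hsat _ (Order.lt_succ _), hsat _ (hmu.trans (Order.lt_succ lam))⟩
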